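/- Let $(X,d)$ be a metric space, let $Y\subseteq\mathbb{R}^m$ be nonempty and compact, where $\mathbb{R}^m$ carries the Euclidean norm, and let $S$ be a map that assigns to each $x\in X$ a nonempty convex compact set $S(x)\subseteq Y$ whose affine hull has dimension $k$, with $k$ independent of $x$. Assume that $S$ is Lipschitz for the Hausdorff distance $d_H$, i.e. $d_H(S(x),S(x'))\le L\,d(x,x')$ for some $L$ and all $x,x'\in X$, and let $\mathrm{Lip}(S)$ be the infimum of such $L$. Let $\lambda_k$ be the $k$-dimensional Hausdorff measure on $\mathbb{R}^m$ (normalized so as to agree with Lebesgue measure on $k$-dimensional affine subspaces). Let $\iota$ be the neutral belief over $S$: for $x\in X$ and $A\subseteq Y$ Borel, $$\iota_x(A)=\frac{\lambda_x(A\cap S(x))}{\lambda_x(S(x))},$$ where $\lambda_x$ is the Lebesgue measure on the affine hull of $S(x)$. For Borel probability measures $\mu,\nu$ on $Y$ let $$d_{W_1}(\mu,\nu)=\sup\Big\{\int f\,d\mu-\int f\,d\nu \;:\; f:Y\to\mathbb{R}\ \text{1-Lipschitz}\Big\},$$ and let $\mathrm{Lip}_{W_1}(\iota,x)=\inf_{\delta>0}\mathrm{Lip}_{W_1}(\iota|_{B(x,\delta)})$,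 where $\mathrm{Lip}_{W_1}(\iota|_{B(x,\delta)})$ is the infimum of the Lipschitz constants of $\iota$ on the open ball $B(x,\delta)$ with respect to $d_{W_1}$ ($+\infty$ if there is none). Then each $\iota_x$ is a Borel probability measure on $Y$ with $\iota_x(S(x))=1$, every $x\in X$ has a ball $B(x,\delta)$, $\delta>0$, on which $\iota$ is Lipschitz with respect to $d_{W_1}$, and $$\mathrm{Lip}_{W_1}(\iota,x)\le\frac{C}{\lambda_k(S(x))^2}\qquad\text{for all }x\in X,$$ where the constant $C$ depends only on $\mathrm{diam}(Y)$, $m$, $k$ and $\mathrm{Lip}(S)$. If moreover $X$ is compact, then $\iota$ is Lipschitz on $X$ with respect to $d_{W_1}$. -/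

import Mathlib

open MeasureTheory
open scoped NNReal ENNReal

noncomputable section

namespace NeutralBelief

/-- `f` is `L`-Lipschitz on `A`, when the distance of the target is the `ℝ≥0∞`-valued function
`d`. -/
def IsLipOn {M N : Type*} [MetricSpace M] (d : N → N → ℝ≥0∞) (f : M → N) (A : Set M)
    (L : ℝ≥0) : Prop :=
  ∀ x ∈ A, ∀ x' ∈ A, d (f x) (f x') ≤ L * edist x x'

/-- `Lip (f|_A)`: the infimum of the Lipschitz constants of `f` on `A` (`∞` if there is none). -/
def lip {M N : Type*} [MetricSpace M] (d : N → N → ℝ≥0∞) (f : M → N) (A : Set M) : ℝ≥0∞ :=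
  ⨅ (L : ℝ≥0) (_ : IsLipOn d f A L), (L : ℝ≥0∞)

/-- `Lip (f, x)`: the infimum over `δ > 0` of `Lip (f|_{B(x, δ)})`. -/
def lipAt {M N : Type*} [MetricSpace M] (d : N → N → ℝ≥0∞) (f : M → N) (x : M) : ℝ≥0∞ :=
  ⨅ (δ : ℝ) (_ : 0 < δ), lip d f (Metric.ball x δ)

/-- The Wasserstein-1 distance, as the supremum of `E_μ[f] - E_ν[f]` over `1`-Lipschitz `f`. -/
def wasserstein1 {Y : Type*} [MetricSpace Y] [MeasurableSpace Y] (μ ν : Measure Y) : ℝ≥0∞ :=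
  ⨆ (f : Y → ℝ) (_ : LipschitzWith 1 f), ENNReal.ofReal (∫ y, f y ∂μ - ∫ y, f y ∂ν)

/-- The dimension of a set: the dimension of its affine hull. -/
def affDim {m : ℕ} (A : Set (EuclideanSpace ℝ (Fin m))) : ℕ :=
  Module.finrank ℝ (affineSpan ℝ A).direction

open Classical in
/-- The Lebesgue measure over the affine space generated by `A`, seen as a measure on `ℝ^m`: the
image of the Lebesgue measure (`volume`) of the direction under `v ↦ v + p`, with `p` a point
of `A` (the choice of `p` does not matter). -/
def affLebesgue {m : ℕ} (A : Set (EuclideanSpace ℝ (Fin m))) :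
    Measure (EuclideanSpace ℝ (Fin m)) :=
  if h : A.Nonempty then
    Measure.map
      (fun v : (affineSpan ℝ A).direction => (v : EuclideanSpace ℝ (Fin m)) + h.some) volume
  else 0

/-- The uniform distribution on `A`, as a measure on `Y`:
`B ↦ affLebesgue A (B ∩ A) / affLebesgue A A`. -/
def uniformOn {m : ℕ} (Y A : Set (EuclideanSpace ℝ (Fin m))) : Measure Y :=
  (affLebesgue A A)⁻¹ • Measure.comap (Subtype.val : Y → _) ((affLebesgue A).restrict A)

/-- The neutral belief over the set-valued map `S`. -/
def neutralBelief {X : Type*} {m : ℕ} (Y : Set (EuclideanSpace ℝ (Fin m)))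
    (S : X → Set (EuclideanSpace ℝ (Fin m))) : X → Measure Y :=
  fun x => uniformOn Y (S x)

/-- `β` is a belief over `S`: every `β x` is a probability measure that concentrates on `S x`. -/
def IsBelief {X : Type*} {m : ℕ} {Y : Set (EuclideanSpace ℝ (Fin m))}
    (S : X → Set (EuclideanSpace ℝ (Fin m))) (β : X → Measure Y) : Prop :=
  ∀ x, IsProbabilityMeasure (β x) ∧ β x {y : Y | (y : EuclideanSpace ℝ (Fin m)) ∈ S x} = 1

end NeutralBelief

end

/-! Integrals against the neutral belief are averages over convex bodies, so `wasserstein1` is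
controlled by comparing averages of a 1-Lipschitz `g`, which may be taken bounded by `D = diam Y`
(`wasserstein1_le_of_forall`).

Let two bodies at Hausdorff distance `h` lie in the same `k`-dimensional space, each containing a
ball of radius `r`. The `h`-neighbourhood of either lies in its dilation by `1 + h / r`, so the body
fills all but a fraction `k * h / r` of their union. Hence each average is within `2 * D * k * h /
r` of the average over the union.

If the affine hulls differ, one body is projected orthogonally onto the hull of the other. For `h <
r` the image still contains a ball of radius `r - h`, so by equality of dimensions the projection is
an affine isomorphism. It preserves averages up to moving points by at most `h`
(`abs_setAverage_add_sub_setAverage_add_le`).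

Finally `r` is bounded below by the volume: a simplex of maximal volume with a vertex at the base
point has volume comparable to that of the body, and its inradius is controlled by its volume and
`D` (`exists_closedBall_subset`). The local constant is then `l * (1 + 8 * k * D / r)`, of order `1
/ λ_k(S x)`; since `λ_k(S x) ≤ 2 ^ k * D ^ k`, the quadratic bound follows. -/

namespace NeutralBelief

/-! ### Inscribed balls and neighbourhoods of convex sets -/

section Geometry

variable {E : Type*} [NormedAddCommGroup E] [InnerProductSpace ℝ E]

/-- If every point of a ball is within `h` of a complete convex set, then the concentric ball of
radius `r - h` is contained in that set. -/
theorem closedBall_sub_subset_of_forall_exists_dist_le {K : Set E} (hK : Convex ℝ K)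
    (hKc : IsComplete K) {p : E} {r h : ℝ} (hr : 0 ≤ r) (hh : 0 ≤ h)
    (H : ∀ y ∈ Metric.closedBall p r, ∃ w ∈ K, dist y w ≤ h) :
    Metric.closedBall p (r - h) ⊆ K := by
  intro y hy
  by_contra hyK
  obtain ⟨w₀, hw₀, -⟩ := H p (Metric.mem_closedBall_self hr)
  obtain ⟨z, hzK, hz⟩ := exists_norm_eq_iInf_of_complete_convex ⟨w₀, hw₀⟩ hKc hK y
  have hz' := (norm_eq_iInf_iff_real_inner_le_zero hK hzK).1 hz
  have hyz : 0 < ‖y - z‖ := norm_pos_iff.2 (sub_ne_zero.2 fun e => hyK (e ▸ hzK))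
  -- Pushing `y` by `h` away from its nearest point `z` stays in the ball of radius `r`, but reaches
  -- distance `‖y - z‖ + h > h` from the half-space that supports `K` at `z`.
  set u : E := ‖y - z‖⁻¹ • (y - z) with hu
  have hu1 : ‖u‖ = 1 := by
    rw [hu, norm_smul, norm_inv, norm_norm, inv_mul_cancel₀ hyz.ne']
  have hyq : y + h • u ∈ Metric.closedBall p r := by
    rw [Metric.mem_closedBall, dist_eq_norm] at hy ⊢
    calc ‖y + h • u - p‖ = ‖(y - p) + h • u‖ := by congr 1; abel
      _ ≤ ‖y - p‖ + ‖h • u‖ := norm_add_le _ _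
      _ ≤ (r - h) + h := by
        rw [norm_smul, hu1, Real.norm_of_nonneg hh, mul_one]; gcongr
      _ = r := by ring
  obtain ⟨w, hw, hdw⟩ := H _ hyq
  have h1 : inner ℝ u (y + h • u - w) ≤ h := by
    calc inner ℝ u (y + h • u - w) ≤ ‖u‖ * ‖y + h • u - w‖ := real_inner_le_norm _ _
      _ ≤ h := by rw [hu1, one_mul, ← dist_eq_norm]; exact hdw
  have h2 : inner ℝ u (y + h • u - w) = ‖y - z‖ + h - inner ℝ u (w - z) := by
    have e : y + h • u - w = (y - z) + h • u - (w - z) := by abel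
    rw [e, inner_sub_right, inner_add_right, inner_smul_right, real_inner_self_eq_norm_sq, hu1]
    congr 1
    rw [hu, real_inner_smul_left, real_inner_self_eq_norm_sq]
    field_simp
  have h3 : inner ℝ u (w - z) ≤ 0 := by
    rw [hu, real_inner_smul_left]
    exact mul_nonpos_of_nonneg_of_nonpos (by positivity) (hz' w hw)
  linarith

/-- A convex set containing a ball of radius `r` has its `h`-neighbourhood contained in its
dilation by `1 + h / r`. -/
theorem mem_image_homothety_of_dist_le {K : Set E} (hK : Convex ℝ K) {p : E} {r h : ℝ}
    (hr : 0 < r) (hh : 0 ≤ h) (hp : Metric.closedBall p r ⊆ K) {x w : E} (hw : w ∈ K)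
    (hx : dist x w ≤ h) : x ∈ AffineMap.homothety p (1 + h / r) '' K := by
  have ht : 0 < 1 + h / r := by positivity
  rcases hh.eq_or_lt with rfl | hh
  · obtain rfl : x = w := dist_le_zero.1 hx
    exact ⟨x, hw, by simp⟩
  have hb : p + (r / h) • (x - w) ∈ K := by
    apply hp
    rw [Metric.mem_closedBall, dist_eq_norm, add_sub_cancel_left, norm_smul, ← dist_eq_norm,
      Real.norm_of_nonneg (by positivity)]
    calc r / h * dist x w ≤ r / h * h := by gcongr
      _ = r := by field_simp
  -- The preimage of `x` is the convex combination of `w` and the point of the inscribed ball in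
  -- direction `x - w`, with weights in ratio `1 : h / r`.
  refine ⟨(1 + h / r)⁻¹ • w + ((1 + h / r)⁻¹ * (h / r)) • (p + (r / h) • (x - w)),
    hK hw hb (by positivity) (by positivity) (by field_simp), ?_⟩
  rw [AffineMap.homothety_apply, vsub_eq_sub, vadd_eq_add]
  match_scalars <;> field_simp <;> ring

end Geometry

/-! ### Averages over nested sets -/

section Average

variable {α : Type*} [MeasurableSpace α] {μ : Measure α}

theorem abs_setAverage_le {s : Set α} {g : α → ℝ} {M : ℝ} (hM : 0 ≤ M)
    (hs' : μ s ≠ ∞) (hg : ∀ x ∈ s, |g x| ≤ M) :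
    |⨍ x in s, g x ∂μ| ≤ M := by
  rw [setAverage_eq, smul_eq_mul, abs_mul, abs_inv, abs_of_nonneg measureReal_nonneg]
  have h1 : |∫ x in s, g x ∂μ| ≤ M * μ.real s :=
    norm_setIntegral_le_of_norm_le_const (f := g) hs'.lt_top hg
  rcases (measureReal_nonneg (μ := μ) (s := s)).eq_or_lt with h0 | h0
  · simpa [← h0] using hM
  · rw [inv_mul_le_iff₀ h0, mul_comm]; exact h1

/-- The average over a set and over a subset differ at most by the relative measure of the
difference. -/
theorem abs_setAverage_sub_le_of_subset {s t : Set α} {g : α → ℝ} {M : ℝ}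
    (hs : MeasurableSet s) (hst : s ⊆ t) (hs0 : μ s ≠ 0) (ht' : μ t ≠ ∞)
    (hgi : IntegrableOn g t μ) (hg : ∀ x ∈ t, |g x| ≤ M) :
    |⨍ x in t, g x ∂μ - ⨍ x in s, g x ∂μ| ≤ 2 * M * (1 - μ.real s / μ.real t) := by
  have hs' : μ s ≠ ∞ := ne_top_of_le_ne_top ht' (measure_mono hst)
  have hsp : 0 < μ.real s := ENNReal.toReal_pos hs0 hs'
  have hle : μ.real s ≤ μ.real t := measureReal_mono hst ht'
  have htp : 0 < μ.real t := hsp.trans_le hle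
  have h1 : |∫ x in t \ s, g x ∂μ| ≤ M * (μ.real t - μ.real s) := by
    rw [← measureReal_sdiff hst hs ht']
    exact norm_setIntegral_le_of_norm_le_const (f := g)
      ((measure_mono Set.sdiff_subset).trans_lt ht'.lt_top) fun x hx => hg x hx.1
  have h2 : ∫ x in t, g x ∂μ = ∫ x in s, g x ∂μ + ∫ x in t \ s, g x ∂μ := by
    rw [setIntegral_sdiff hs hgi hst]; ring
  have h3 : |∫ x in s, g x ∂μ| ≤ M * μ.real s :=
    norm_setIntegral_le_of_norm_le_const (f := g) hs'.lt_top fun x hx => hg x (hst hx)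
  rw [setAverage_eq, setAverage_eq, smul_eq_mul, smul_eq_mul, h2]
  set a := ∫ x in s, g x ∂μ
  set b := ∫ x in t \ s, g x ∂μ
  set σ := μ.real s
  set τ := μ.real t
  have e : τ⁻¹ * (a + b) - σ⁻¹ * a = τ⁻¹ * b - (τ - σ) / τ * (σ⁻¹ * a) := by
    field_simp; ring
  have h4 : |σ⁻¹ * a| ≤ M := by
    rw [abs_mul, abs_of_pos (inv_pos.2 hsp), inv_mul_le_iff₀ hsp, mul_comm]; exact h3
  have h5 : 0 ≤ (τ - σ) / τ := div_nonneg (sub_nonneg.2 hle) htp.le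
  calc |τ⁻¹ * (a + b) - σ⁻¹ * a| ≤ |τ⁻¹ * b| + |(τ - σ) / τ * (σ⁻¹ * a)| := by
        rw [e]; exact abs_sub _ _
    _ ≤ τ⁻¹ * (M * (τ - σ)) + (τ - σ) / τ * M := by
        rw [abs_mul, abs_mul, abs_of_pos (inv_pos.2 htp), abs_of_nonneg h5]; gcongr
    _ = 2 * M * (1 - σ / τ) := by field_simp; ring

end Average

/-! ### Averages over nearby bodies in one space -/

section AverageConvex

variable {E : Type*} [NormedAddCommGroup E] [InnerProductSpace ℝ E] [FiniteDimensional ℝ E]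
  [MeasurableSpace E] [BorelSpace E]

theorem measure_ne_zero_of_closedBall_subset {K : Set E} {p : E} {r : ℝ} (hr : 0 < r)
    (hp : Metric.closedBall p r ⊆ K) : (volume : Measure E) K ≠ 0 :=
  ((Metric.measure_closedBall_pos volume p hr).trans_le (measure_mono hp)).ne'

/-- If a set `U` lies in the `h`-neighbourhood of its convex subset `K`, then `K` has almost
the full measure of `U`. -/
theorem one_sub_measureReal_div_le {K U : Set E} (hK : Convex ℝ K) (hKc : IsCompact K)
    (hU : IsCompact U) (hKU : K ⊆ U) {p : E} {r h : ℝ} (hr : 0 < r) (hh : 0 ≤ h)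
    (hp : Metric.closedBall p r ⊆ K) (H : ∀ x ∈ U, ∃ w ∈ K, dist x w ≤ h) :
    1 - (volume : Measure E).real K / (volume : Measure E).real U
      ≤ Module.finrank ℝ E * (h / r) := by
  have hsub : U ⊆ AffineMap.homothety p (1 + h / r) '' K := fun x hx => by
    obtain ⟨w, hw, hxw⟩ := H x hx
    exact mem_image_homothety_of_dist_le hK hr hh hp hw hxw
  have hKp : 0 < (volume : Measure E).real K :=
    ENNReal.toReal_pos (measure_ne_zero_of_closedBall_subset hr hp) hKc.measure_ne_top
  have hUp : 0 < (volume : Measure E).real U :=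
    hKp.trans_le (measureReal_mono hKU hU.measure_ne_top)
  set n := Module.finrank ℝ E
  have hpow : 0 < (1 + h / r) ^ n := by positivity
  have hle : (volume : Measure E).real U ≤ (1 + h / r) ^ n * (volume : Measure E).real K := by
    have := measure_mono (μ := (volume : Measure E)) hsub
    rw [Measure.addHaar_image_homothety, abs_of_pos hpow] at this
    have h2 := ENNReal.toReal_mono (ENNReal.mul_ne_top ENNReal.ofReal_ne_top hKc.measure_ne_top)
      this
    rwa [ENNReal.toReal_mul, ENNReal.toReal_ofReal hpow.le] at h2
  have hs : 0 ≤ h / r := by positivity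
  have h1 : ((1 + h / r) ^ n)⁻¹ ≤ (volume : Measure E).real K / (volume : Measure E).real U := by
    rw [inv_le_iff_one_le_mul₀ hpow, div_mul_eq_mul_div, le_div_iff₀ hUp, one_mul, mul_comm]
    exact hle
  -- Bernoulli's inequality for the base `(1 + h / r)⁻¹ ≥ 1 - h / r`.
  have h2 : 1 - n * (h / r) ≤ ((1 + h / r) ^ n)⁻¹ := by
    have h3 : 1 - h / r ≤ (1 + h / r)⁻¹ := by
      rw [← one_div, le_div_iff₀ (by positivity)]
      nlinarith
    have h4 : 0 < (1 + h / r)⁻¹ := by positivity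
    have h5 := one_add_mul_le_pow (show -2 ≤ (1 + h / r)⁻¹ - 1 by linarith) n
    rw [add_sub_cancel, inv_pow] at h5
    refine le_trans ?_ h5
    nlinarith [(Nat.cast_nonneg n : (0 : ℝ) ≤ n)]
  linarith

/-- Averages over two convex bodies at Hausdorff distance at most `h`. -/
theorem abs_setAverage_sub_setAverage_le {K K' : Set E} (hK : Convex ℝ K) (hKc : IsCompact K)
    (hK' : Convex ℝ K') (hKc' : IsCompact K') {p p' : E} {r h : ℝ} (hr : 0 < r) (hh : 0 ≤ h)
    (hp : Metric.closedBall p r ⊆ K) (hp' : Metric.closedBall p' r ⊆ K')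
    (H : ∀ x ∈ K, ∃ w ∈ K', dist x w ≤ h) (H' : ∀ x ∈ K', ∃ w ∈ K, dist x w ≤ h)
    {g : E → ℝ} (hgc : Continuous g) {M : ℝ} (hM : 0 ≤ M) (hg : ∀ x ∈ K ∪ K', |g x| ≤ M) :
    |(⨍ x in K, g x) - ⨍ x in K', g x| ≤ 4 * M * (Module.finrank ℝ E * (h / r)) := by
  -- Both averages are compared with the one over the union, which need not be convex: only the
  -- smaller body gets dilated.
  have hU : IsCompact (K ∪ K') := hKc.union hKc'
  have hgi : IntegrableOn g (K ∪ K') := hgc.continuousOn.integrableOn_compact hU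
  have h1 := abs_setAverage_sub_le_of_subset hKc.measurableSet
    Set.subset_union_left (measure_ne_zero_of_closedBall_subset hr hp) hU.measure_ne_top hgi hg
  have h2 := abs_setAverage_sub_le_of_subset hKc'.measurableSet
    Set.subset_union_right (measure_ne_zero_of_closedBall_subset hr hp') hU.measure_ne_top hgi hg
  have h3 := one_sub_measureReal_div_le hK hKc hU Set.subset_union_left hr hh hp
    (by rintro x (hx | hx)
        · exact ⟨x, hx, by simpa using hh⟩
        · exact H' x hx)
  have h4 := one_sub_measureReal_div_le hK' hKc' hU Set.subset_union_right hr hh hp'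
    (by rintro x (hx | hx)
        · exact H x hx
        · exact ⟨x, hx, by simpa using hh⟩)
  have h5 := mul_le_mul_of_nonneg_left h3 (by positivity : 0 ≤ 2 * M)
  have h6 := mul_le_mul_of_nonneg_left h4 (by positivity : 0 ≤ 2 * M)
  rw [abs_le] at h1 h2 ⊢
  constructor <;> linarith

end AverageConvex

/-! ### Lower bound for the inradius in terms of the volume -/

section Inradius

variable {E : Type*} [NormedAddCommGroup E] [InnerProductSpace ℝ E]

/-- Hadamard's inequality for the determinant in an orthonormal basis. -/
theorem abs_det_orthonormalBasis_le {n : ℕ} (b : OrthonormalBasis (Fin n) ℝ E) (v : Fin n → E) :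
    |b.toBasis.det v| ≤ ∏ i, ‖v i‖ := by
  have : Fact (Module.finrank ℝ E = n) :=
    ⟨by simpa using Module.finrank_eq_card_basis b.toBasis⟩
  rw [← b.toBasis.orientation.volumeForm_robust' b]
  exact b.toBasis.orientation.abs_volumeForm_apply_le v

/-- Cramer's rule for an alternating form. -/
theorem repr_mul_alternatingMap_apply {ι : Type*} [Fintype ι] [DecidableEq ι]
    (ω : E [⋀^ι]→ₗ[ℝ] ℝ) (e : Module.Basis ι ℝ E) (y : E) (i : ι) :
    e.repr y i * ω e = ω (Function.update e i y) := by
  conv_rhs => rw [← e.sum_repr y]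
  rw [AlternatingMap.map_update_sum, Finset.sum_eq_single i]
  · rw [AlternatingMap.map_update_smul, Function.update_eq_self, smul_eq_mul]
  · intro j _ hj
    rw [AlternatingMap.map_update_smul, AlternatingMap.map_update_self _ _ hj.symm, smul_zero]
  · simp

theorem sum_smul_mem_of_zero_mem {ι : Type*} [Fintype ι] {K : Set E} (hK : Convex ℝ K)
    (h0 : (0 : E) ∈ K) {e : ι → E} (he : ∀ i, e i ∈ K) {c : ι → ℝ} (hc : ∀ i, 0 ≤ c i)
    (hsum : ∑ i, c i ≤ 1) : ∑ i, c i • e i ∈ K := by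
  -- The index `none` puts the missing weight `1 - ∑ i, c i` on the origin.
  have := hK.sum_mem (t := Finset.univ) (w := fun o : Option ι => o.elim (1 - ∑ i, c i) c)
    (z := fun o : Option ι => o.elim 0 e)
    (by rintro (_ | i) -
        · simpa using hsum
        · exact hc i)
    (by simp [Fintype.sum_option])
    (by rintro (_ | i) -
        · exact h0
        · exact he i)
  simpa [Fintype.sum_option] using this

variable [FiniteDimensional ℝ E]

theorem continuous_basis_det {ι : Type*} [Fintype ι] [DecidableEq ι] (b : Module.Basis ι ℝ E) :
    Continuous fun v : ι → E => b.det v := by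
  simp only [Module.Basis.det_apply]
  refine Continuous.matrix_det (continuous_matrix fun i j => ?_)
  simp only [Module.Basis.toMatrix_apply]
  exact (b.coord i).continuous_of_finiteDimensional.comp (continuous_apply j)

/-- A compact spanning set contains a basis of maximal volume. -/
theorem exists_basis_mem_forall_abs_det_le {n : ℕ} (b : OrthonormalBasis (Fin n) ℝ E) {K : Set E}
    (hK : IsCompact K) (hspan : Submodule.span ℝ K = ⊤) :
    ∃ e : Module.Basis (Fin n) ℝ E, (∀ i, e i ∈ K) ∧
      ∀ v : Fin n → E, (∀ i, v i ∈ K) → |b.toBasis.det v| ≤ |b.toBasis.det e| := by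
  have hn : Module.finrank ℝ E = n := by simpa using Module.finrank_eq_card_basis b.toBasis
  obtain ⟨f, hfK, -, hf⟩ : ∃ f : Fin n → E, (∀ i, f i ∈ K) ∧
      Submodule.span ℝ (Set.range f) = Submodule.span ℝ K ∧ LinearIndependent ℝ f := by
    have h := Submodule.exists_fun_fin_finrank_span_eq ℝ K
    have h' : Module.finrank ℝ (Submodule.span ℝ K) = n := by rw [hspan, finrank_top, hn]
    rw [h'] at h
    exact h
  obtain ⟨e, heK, he⟩ := (isCompact_univ_pi fun _ : Fin n => hK).exists_isMaxOn
    ⟨f, fun i _ => hfK i⟩ (continuous_basis_det b.toBasis).abs.continuousOn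
  have hmax : ∀ v : Fin n → E, (∀ i, v i ∈ K) → |b.toBasis.det v| ≤ |b.toBasis.det e| :=
    fun v hv => he fun i _ => hv i
  -- Some basis lies in `K`, so the maximum is nonzero and the maximizer is itself a basis.
  have hfdet : b.toBasis.det f ≠ 0 := by
    have hcard : Fintype.card (Fin n) = Module.finrank ℝ E := by simp [hn]
    have := b.toBasis.isUnit_det (basisOfLinearIndependentOfCardEqFinrank' f hf hcard)
    simpa using this.ne_zero
  have hedet : b.toBasis.det e ≠ 0 := by
    intro h0
    have := hmax f hfK
    rw [h0, abs_zero] at this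
    exact hfdet (abs_nonpos_iff.1 this)
  obtain ⟨hli, hsp⟩ := (b.toBasis.is_basis_iff_det (v := e)).2 hedet.isUnit
  refine ⟨Module.Basis.mk hli hsp.ge, fun i => ?_, fun v hv => ?_⟩
  · rw [Module.Basis.mk_apply]; exact heK i trivial
  · rw [Module.Basis.coe_mk]; exact hmax v hv

variable [MeasurableSpace E] [BorelSpace E]

/-- A convex body of diameter at most `D` contains a ball whose radius is controlled from below
by the volume of the body. -/
theorem exists_closedBall_subset {K : Set E} (hK : Convex ℝ K) (hKc : IsCompact K)
    (h0 : (0 : E) ∈ K) (hspan : Submodule.span ℝ K = ⊤) {n : ℕ} (hn : Module.finrank ℝ E = n)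
    {D : ℝ} (hD : ∀ x ∈ K, ‖x‖ ≤ D) :
    ∃ r > 0, ∃ p : E, Metric.closedBall p r ⊆ K ∧
      n * D * (volume : Measure E).real K ≤ n ^ 2 * (n + 1) * 2 ^ n * D ^ n * r ∧
      (volume : Measure E).real K ≤ 2 ^ n * D ^ n := by
  have b : OrthonormalBasis (Fin n) ℝ E := (stdOrthonormalBasis ℝ E).reindex (finCongr hn)
  obtain ⟨e, heK, hmax⟩ := exists_basis_mem_forall_abs_det_le b hKc hspan
  have hD0 : 0 ≤ D := (norm_nonneg _).trans (hD 0 h0)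
  set V : ℝ := |b.toBasis.det e| with hV
  have hVpos : 0 < V := abs_pos.2 (b.toBasis.isUnit_det e).ne_zero
  have hVD : V ≤ D ^ n := by
    refine (abs_det_orthonormalBasis_le b e).trans ?_
    refine (Finset.prod_le_prod (fun i _ => norm_nonneg _) fun i _ => hD _ (heK i)).trans ?_
    simp
  have hcramer : ∀ y i, |e.repr y i| * V = |b.toBasis.det (Function.update e i y)| := fun y i => by
    rw [hV, ← abs_mul, repr_mul_alternatingMap_apply]
  -- Replacing `e i` by a point of `K` cannot increase the maximal determinant; by Cramer's rule
  -- this bounds the coordinate by 1.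
  have hcoordK : ∀ y ∈ K, ∀ i, |e.repr y i| ≤ 1 := fun y hy i => by
    have h := hmax (Function.update e i y) fun j => by
      rcases eq_or_ne j i with rfl | hj
      · simpa using hy
      · simpa [hj] using heK j
    rw [← hcramer] at h
    exact (mul_le_iff_le_one_left hVpos).1 h
  -- Cramer's rule and Hadamard's inequality give `|e.repr y i| * V ≤ ‖y‖ * D ^ (n - 1)`; the extra
  -- factor `D` avoids the truncated exponent.
  have hcoord : ∀ y i, |e.repr y i| * V * D ≤ ‖y‖ * D ^ n := fun y i => by
    rw [hcramer]
    have h1 := abs_det_orthonormalBasis_le b (Function.update e i y)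
    rw [← Finset.mul_prod_erase _ _ (Finset.mem_univ i), Function.update_self] at h1
    have h2 : ∏ j ∈ Finset.univ.erase i, ‖Function.update e i y j‖ ≤ D ^ (n - 1) := by
      refine (Finset.prod_le_prod (g := fun _ => D) (fun j _ => norm_nonneg _)
        fun j hj => ?_).trans ?_
      · rw [Function.update_of_ne (Finset.ne_of_mem_erase hj)]; exact hD _ (heK j)
      · simp
    have hpos : 0 < n := i.pos
    calc |b.toBasis.det (Function.update e i y)| * D ≤ ‖y‖ * D ^ (n - 1) * D := by
          gcongr
          exact h1.trans (by gcongr)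
      _ = ‖y‖ * D ^ n := by
          rw [mul_assoc, ← pow_succ, Nat.sub_add_cancel hpos]
  have hvol : (volume : Measure E).real K ≤ 2 ^ n * V := by
    -- Doubling about `∑ i, e i` sends coordinates `t` to `2 * t - 1`, hence `[0, 1]` onto `[-1,
    -- 1]`.
    have hsub : K ⊆ AffineMap.homothety (∑ i, e i) (2 : ℝ) '' parallelepiped e := fun y hy => by
      refine ⟨∑ i, ((e.repr y i + 1) / 2) • e i, ?_, ?_⟩
      · rw [mem_parallelepiped_iff]
        refine ⟨fun i => (e.repr y i + 1) / 2, ⟨fun i => ?_, fun i => ?_⟩, rfl⟩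
        · have := (abs_le.1 (hcoordK y hy i)).1
          simp only [Pi.zero_apply]; linarith
        · have := (abs_le.1 (hcoordK y hy i)).2
          simp only [Pi.one_apply]; linarith
      · rw [AffineMap.homothety_apply, vsub_eq_sub, vadd_eq_add]
        conv_rhs => rw [← e.sum_repr y]
        rw [← Finset.sum_sub_distrib, Finset.smul_sum, ← Finset.sum_add_distrib]
        refine Finset.sum_congr rfl fun i _ => ?_
        match_scalars
        ring
    have h1 := measure_mono (μ := (volume : Measure E)) hsub
    rw [Measure.addHaar_image_homothety, ← b.addHaar_eq_volume, Measure.addHaar_parallelepiped,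
      ← hV, hn, abs_of_nonneg (by positivity), ← ENNReal.ofReal_mul (by positivity)] at h1
    rw [← b.addHaar_eq_volume]
    exact ENNReal.toReal_le_of_le_ofReal (by positivity) h1
  rcases Nat.eq_zero_or_pos n with rfl | hnpos
  · have : Subsingleton E := Module.finrank_zero_iff.1 hn
    refine ⟨1, one_pos, 0, fun y _ => by rwa [Subsingleton.elim y 0], by simp, ?_⟩
    exact hvol.trans (by gcongr)
  have hDpos : 0 < D := by
    rcases hD0.eq_or_lt with rfl | h
    · rw [zero_pow hnpos.ne'] at hVD; linarith
    · exact h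
  have hn' : (1 : ℝ) ≤ n := by exact_mod_cast hnpos
  have hDn : 0 < D ^ n := by positivity
  -- The centre is the barycentre of the simplex with vertices `0` and the `e i`. The radius lets
  -- coordinates vary by at most `1 / (n * (n + 1))`, so they stay nonnegative with sum at most `n /
  -- (n + 1) + 1 / (n + 1) = 1`.
  refine ⟨V * D / (n * (n + 1) * D ^ n), by positivity, ∑ i, ((n : ℝ) + 1)⁻¹ • e i, ?_, ?_, ?_⟩
  · intro y hy
    rw [Metric.mem_closedBall, dist_eq_norm] at hy
    have hc : ∀ i, |e.repr y i - ((n : ℝ) + 1)⁻¹| ≤ (n * ((n : ℝ) + 1))⁻¹ := fun i => by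
      have h1 : e.repr (y - ∑ i, ((n : ℝ) + 1)⁻¹ • e i) i = e.repr y i - ((n : ℝ) + 1)⁻¹ := by
        rw [map_sub, Finsupp.sub_apply, e.repr_sum_self]
      have h2 := (hcoord (y - ∑ i, ((n : ℝ) + 1)⁻¹ • e i) i).trans
        (mul_le_mul_of_nonneg_right hy hDn.le)
      rw [h1] at h2
      have h3 : V * D / (n * (n + 1) * D ^ n) * D ^ n = (n * ((n : ℝ) + 1))⁻¹ * (V * D) := by
        field_simp
      rw [h3, mul_assoc] at h2
      exact le_of_mul_le_mul_right h2 (by positivity)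
    rw [← e.sum_repr y]
    refine sum_smul_mem_of_zero_mem hK h0 heK (fun i => ?_) ?_
    · have h1 := (abs_le.1 (hc i)).1
      have h2 : (n * ((n : ℝ) + 1))⁻¹ ≤ ((n : ℝ) + 1)⁻¹ := by
        apply inv_anti₀ (by positivity)
        nlinarith
      linarith
    · calc ∑ i, e.repr y i ≤ ∑ _i : Fin n, (((n : ℝ) + 1)⁻¹ + (n * ((n : ℝ) + 1))⁻¹) :=
            Finset.sum_le_sum fun i _ => by linarith [(abs_le.1 (hc i)).2]
        _ = 1 := by
          rw [Finset.sum_const, Finset.card_univ, Fintype.card_fin, nsmul_eq_mul]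
          field_simp
  · calc n * D * (volume : Measure E).real K ≤ n * D * (2 ^ n * V) := by gcongr
      _ = n ^ 2 * (n + 1) * 2 ^ n * D ^ n * (V * D / (n * (n + 1) * D ^ n)) := by
        field_simp
  · exact hvol.trans (by gcongr)

end Inradius

/-! ### Bodies spanning different affine subspaces -/

section Projection

/-- Averages over sets are invariant under affine changes of variables. -/
theorem setAverage_image_add_continuousLinearEquiv {E F : Type*}
    [NormedAddCommGroup E] [InnerProductSpace ℝ E] [FiniteDimensional ℝ E] [MeasurableSpace E]
    [BorelSpace E] [NormedAddCommGroup F] [InnerProductSpace ℝ F] [FiniteDimensional ℝ F]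
    [MeasurableSpace F] [BorelSpace F] (L : E ≃L[ℝ] F) (c : F) (K : Set E) (g : F → ℝ) :
    ⨍ x in (fun w => c + L w) '' K, g x = ⨍ w in K, g (c + L w) := by
  let e : E ≃ᵐ F := (L.toHomeomorph.trans (Homeomorph.addLeft c)).toMeasurableEquiv
  have he : ∀ w, e w = c + L w := fun w => rfl
  have : (Measure.map L (volume : Measure E)).IsAddHaarMeasure := L.isAddHaarMeasure_map _
  have hmap : Measure.map e (volume : Measure E) = Measure.map L volume := by
    rw [← map_add_left_eq_self (Measure.map L volume) c,
      Measure.map_map (by fun_prop) L.continuous.measurable]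
    rfl
  -- The pushforward of Lebesgue measure is again a Haar measure; the scaling factor `s` cancels in
  -- averages.
  obtain ⟨s, hs0, hs⟩ : ∃ s : ℝ≥0, s ≠ 0 ∧
      (volume : Measure F) = s • Measure.map e (volume : Measure E) := by
    rw [hmap]
    exact ⟨_, (Measure.addHaarScalarFactor_pos_of_isAddHaarMeasure _ _).ne',
      Measure.isAddLeftInvariant_eq_smul _ _⟩
  have himg : e ⁻¹' ((fun w => c + L w) '' K) = K :=
    Set.preimage_image_eq K e.injective
  have hs0' : (s : ℝ) ≠ 0 := by exact_mod_cast hs0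
  rw [setAverage_eq, setAverage_eq, hs, Measure.restrict_smul, integral_smul_nnreal_measure,
    setIntegral_map_equiv, himg, measureReal_nnreal_smul_apply, Measure.real, e.map_apply, himg]
  simp only [he, NNReal.smul_def, smul_eq_mul, Measure.real]
  field_simp

variable {F : Type*} [NormedAddCommGroup F] [InnerProductSpace ℝ F] [FiniteDimensional ℝ F]
  {V W : Submodule ℝ F}

/-- The orthogonal projection of the affine subspace `W + q` to `V + p`, in coordinates. -/
noncomputable def affProj (V : Submodule ℝ F) {W : Submodule ℝ F} (p q : F) (w : W) : V :=
  V.orthogonalProjectionOnto (q - p) + V.orthogonalProjectionOnto (w : F)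

/-- The projection is 1-Lipschitz and fixes the points of `V + p`. -/
theorem dist_affProj_le (p q : F) (v : V) (w : W) :
    dist v (affProj V p q w) ≤ dist ((v : F) + p) (w + q) := by
  have h : v - affProj V p q w = V.orthogonalProjectionOnto ((v + p) - (w + q)) := by
    have : ((v : F) + p) - (w + q) = v - ((q - p) + w) := by abel
    rw [this, map_sub, map_add, Submodule.orthogonalProjectionOnto_mem_subspace_eq_self]
    rfl
  rw [dist_eq_norm, dist_eq_norm, h]
  exact V.norm_orthogonalProjectionOnto_apply_le _

/-- The projection of `w + q` is its nearest point in `V + p`. -/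
theorem dist_affProj_add_le (p q : F) (v : V) (w : W) :
    dist ((affProj V p q w : F) + p) (w + q) ≤ dist ((v : F) + p) (w + q) := by
  have h1 : (affProj V p q w : F) = V.starProjection ((q - p) + w) := by
    rw [map_add]; rfl
  have h2 := V.starProjection_minimal ((q - p) + (w : F))
  have h3 : ‖(q - p) + (w : F) - V.starProjection ((q - p) + (w : F))‖ ≤ ‖(q - p) + (w : F) - v‖ := by
    rw [h2]
    exact ciInf_le ⟨0, by rintro _ ⟨x, rfl⟩; exact norm_nonneg _⟩ v
  rw [dist_comm, dist_comm _ ((w : F) + q), dist_eq_norm, dist_eq_norm, h1]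
  convert! h3 using 2 <;> abel

theorem dist_affProj_affProj_le (p q : F) (w w' : W) :
    dist (affProj V p q w) (affProj V p q w') ≤ dist w w' := by
  have h : affProj V p q w - affProj V p q w' = V.orthogonalProjectionOnto ((w : F) - w') := by
    rw [map_sub]; simp [affProj]
  rw [dist_eq_norm, dist_eq_norm, h]
  exact V.norm_orthogonalProjectionOnto_apply_le _

theorem convex_image_affProj (p q : F) {K' : Set W} (hK' : Convex ℝ K') :
    Convex ℝ (affProj V p q '' K') := by
  have := (hK'.linear_image (V.orthogonalProjectionOnto.toLinearMap ∘ₗ W.subtype)).translate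
    (V.orthogonalProjectionOnto (q - p))
  rwa [Set.image_image] at this

theorem continuous_affProj (p q : F) : Continuous (affProj V p q : W → V) := by
  unfold affProj; fun_prop

/-- The projected body is convex and, projections being contractions, still within `h` of every
point of the ball, so the ball shrinks by at most `h`. -/
theorem closedBall_subset_image_affProj {K : Set V} {K' : Set W} {p q : F} {c : V} {r h : ℝ}
    (hK' : Convex ℝ K') (hKc' : IsCompact K') (hr : 0 ≤ r) (hh : 0 ≤ h)
    (hc : Metric.closedBall c r ⊆ K)
    (H : ∀ v ∈ K, ∃ w ∈ K', dist ((v : F) + p) (w + q) ≤ h) :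
    Metric.closedBall c (r - h) ⊆ affProj V p q '' K' := by
  refine closedBall_sub_subset_of_forall_exists_dist_le (convex_image_affProj p q hK')
    (hKc'.image (continuous_affProj p q)).isComplete hr hh fun y hy => ?_
  obtain ⟨w, hw, hd⟩ := H y (hc hy)
  exact ⟨_, ⟨w, hw, rfl⟩, (dist_affProj_le p q y w).trans hd⟩

/-- If the projection of a subset of `W + q` contains a ball of `V + p`, and `V`, `W` have the same
dimension, then the projection is an affine isomorphism. -/
theorem exists_continuousLinearEquiv_affProj (hVW : Module.finrank ℝ V = Module.finrank ℝ W)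
    {K' : Set W} {p q : F} {c : V} {ρ : ℝ} (hρ : 0 < ρ)
    (hc : Metric.closedBall c ρ ⊆ affProj V p q '' K') :
    ∃ L : W ≃L[ℝ] V, ∀ w, affProj V p q w = V.orthogonalProjectionOnto (q - p) + L w := by
  let T : W →ₗ[ℝ] V := V.orthogonalProjectionOnto.toLinearMap ∘ₗ W.subtype
  have hsurj : Function.Surjective T := by
    rw [← LinearMap.range_eq_top, eq_top_iff]
    rintro v -
    obtain ⟨w₀, -, hw₀⟩ := hc (Metric.mem_closedBall_self hρ.le)
    rcases eq_or_ne v 0 with rfl | hv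
    · exact Submodule.zero_mem _
    have hvn : 0 < ‖v‖ := norm_pos_iff.2 hv
    obtain ⟨w₁, -, hw₁⟩ := @hc (c + (ρ / ‖v‖) • v) (by
      rw [Metric.mem_closedBall, dist_eq_norm, add_sub_cancel_left, norm_smul, Real.norm_eq_abs,
        abs_of_pos (by positivity), div_mul_cancel₀ _ hvn.ne'])
    have h1 : T (w₁ - w₀) = (ρ / ‖v‖) • v := by
      have : T (w₁ - w₀) = affProj V p q w₁ - affProj V p q w₀ := by
        rw [map_sub]; simp [affProj, T]
      rw [this, hw₁, hw₀, add_sub_cancel_left]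
    refine (Submodule.smul_mem_iff _ (show ρ / ‖v‖ ≠ 0 by positivity)).1 ?_
    exact h1 ▸ LinearMap.mem_range_self T _
  have hinj : Function.Injective T :=
    (LinearMap.injective_iff_surjective_of_finrank_eq_finrank hVW.symm).2 hsurj
  exact ⟨(LinearEquiv.ofBijective T ⟨hinj, hsurj⟩).toContinuousLinearEquiv, fun w => rfl⟩

/-- A convex body close to one with an inscribed ball of radius `r` has an inscribed ball of radius
`r - h`, even if it spans another affine subspace of the same dimension. -/
theorem exists_closedBall_sub_subset (hVW : Module.finrank ℝ V = Module.finrank ℝ W)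
    {K : Set V} {K' : Set W} {p q : F} {c : V} {r h : ℝ}
    (hK' : Convex ℝ K') (hKc' : IsCompact K') (hh : 0 ≤ h) (hhr : h < r)
    (hc : Metric.closedBall c r ⊆ K)
    (H : ∀ v ∈ K, ∃ w ∈ K', dist ((v : F) + p) (w + q) ≤ h) :
    ∃ c' : W, Metric.closedBall c' (r - h) ⊆ K' := by
  have hball := closedBall_subset_image_affProj hK' hKc' (hh.trans hhr.le) hh hc H
  obtain ⟨L, hL⟩ := exists_continuousLinearEquiv_affProj hVW (sub_pos.2 hhr) hball
  obtain ⟨c', -, hc'⟩ := hball (Metric.mem_closedBall_self (sub_pos.2 hhr).le)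
  -- The projection contracts, so `w` lands in the ball covered by the image of `K'`; injectivity
  -- then forces `w` itself into `K'`.
  refine ⟨c', fun w hw => ?_⟩
  obtain ⟨w', hw', hww'⟩ := @hball (affProj V p q w) (by
    rw [← hc']
    exact (dist_affProj_affProj_le p q w c').trans hw)
  rw [hL, hL] at hww'
  rwa [← L.injective (add_left_cancel hww')]

variable [MeasurableSpace F] [BorelSpace F]

/-- Averages of a bounded `1`-Lipschitz function over two convex bodies at Hausdorff distance at
most `h`, which span affine subspaces of the same dimension. -/
theorem abs_setAverage_add_sub_setAverage_add_le
    (hVW : Module.finrank ℝ V = Module.finrank ℝ W)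
    {K : Set V} {K' : Set W} {p q : F} {c : V} {r h : ℝ} (hK : Convex ℝ K) (hKc : IsCompact K)
    (hK' : Convex ℝ K') (hKc' : IsCompact K') (hh : 0 ≤ h) (hhr : h < r)
    (hc : Metric.closedBall c r ⊆ K)
    (H : ∀ v ∈ K, ∃ w ∈ K', dist ((v : F) + p) (w + q) ≤ h)
    (H' : ∀ w ∈ K', ∃ v ∈ K, dist ((v : F) + p) (w + q) ≤ h)
    {g : F → ℝ} (hg : LipschitzWith 1 g) {M : ℝ} (hM : 0 ≤ M) (hgM : ∀ x, |g x| ≤ M) :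
    |(⨍ v in K, g (v + p)) - ⨍ w in K', g (w + q)| ≤
      h + 4 * M * (Module.finrank ℝ V * (h / (r - h))) := by
  have hrh : 0 < r - h := sub_pos.2 hhr
  have hball := closedBall_subset_image_affProj hK' hKc' (hh.trans hhr.le) hh hc H
  obtain ⟨L, hL⟩ := exists_continuousLinearEquiv_affProj hVW hrh hball
  have hgp : Continuous fun v : V => g (v + p) := hg.continuous.comp (by fun_prop)
  have hgq : Continuous fun w : W => g (w + q) := hg.continuous.comp (by fun_prop)
  have hgpq : Continuous fun w : W => g (affProj V p q w + p) :=
    hgp.comp (continuous_affProj p q)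
  -- `K` and the projected `K'` lie in one space, are within `h` of each other and both contain the
  -- ball of radius `r - h` about `c`.
  have h1 := abs_setAverage_sub_setAverage_le (h := h) hK hKc (convex_image_affProj p q hK')
    (hKc'.image (continuous_affProj p q)) hrh hh
    ((Metric.closedBall_subset_closedBall (by linarith)).trans hc) hball
    (fun v hv => by
      obtain ⟨w, hw, hd⟩ := H v hv
      exact ⟨_, ⟨w, hw, rfl⟩, (dist_affProj_le p q v w).trans hd⟩)
    (by
      rintro _ ⟨w, hw, rfl⟩
      obtain ⟨v, hv, hd⟩ := H' w hw
      exact ⟨v, hv, by rw [dist_comm]; exact (dist_affProj_le p q v w).trans hd⟩)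
    hgp hM fun v _ => hgM _
  have h2 : ⨍ v in affProj V p q '' K', g (v + p) = ⨍ w in K', g (affProj V p q w + p) := by
    have := setAverage_image_add_continuousLinearEquiv L (V.orthogonalProjectionOnto (q - p)) K'
      (fun v => g (v + p))
    simpa only [← hL] using this
  have h3 : |(⨍ w in K', g (affProj V p q w + p)) - ⨍ w in K', g (w + q)| ≤ h := by
    have hi1 := hgpq.continuousOn.integrableOn_compact (μ := volume) hKc'
    have hi2 := hgq.continuousOn.integrableOn_compact (μ := volume) hKc'
    have e : (⨍ w in K', g (affProj V p q w + p)) - ⨍ w in K', g (w + q) =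
        ⨍ w in K', (g (affProj V p q w + p) - g (w + q)) := by
      rw [setAverage_eq, setAverage_eq, setAverage_eq, integral_sub hi1 hi2, smul_sub]
    rw [e]
    refine abs_setAverage_le hh hKc'.measure_ne_top fun w hw => ?_
    obtain ⟨v, -, hd⟩ := H' w hw
    have h4 := hg.dist_le_mul (affProj V p q w + p) (w + q)
    rw [NNReal.coe_one, one_mul, Real.dist_eq] at h4
    exact (h4.trans (dist_affProj_add_le p q v w)).trans hd
  rw [h2] at h1
  calc _ ≤ _ := abs_sub_le _ (⨍ w in K', g (affProj V p q w + p)) _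
    _ ≤ _ := by linarith

end Projection

/-! ### Coordinates on the affine hull -/

section Slice

variable {m : ℕ} {A : Set (EuclideanSpace ℝ (Fin m))} {p : EuclideanSpace ℝ (Fin m)}

/-- The set `A - p`, as a subset of the direction of the affine hull of `A`. -/
def slice (A : Set (EuclideanSpace ℝ (Fin m))) (p : EuclideanSpace ℝ (Fin m)) :
    Set (affineSpan ℝ A).direction :=
  (fun v => (v : EuclideanSpace ℝ (Fin m)) + p) ⁻¹' A

theorem isometry_coe_add (V : Submodule ℝ (EuclideanSpace ℝ (Fin m)))
    (p : EuclideanSpace ℝ (Fin m)) :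
    Isometry fun v : V => (v : EuclideanSpace ℝ (Fin m)) + p :=
  (isometry_add_right p).comp isometry_subtype_coe

theorem convex_slice (hA : Convex ℝ A) : Convex ℝ (slice A p) := by
  have h := (hA.translate_preimage_left p).linear_preimage (affineSpan ℝ A).direction.subtype
  exact h

theorem isCompact_slice (hA : IsCompact A) : IsCompact (slice A p) :=
  (isometry_coe_add _ p).isClosedEmbedding.isCompact_preimage hA

theorem exists_mem_slice (hp : p ∈ A) {a : EuclideanSpace ℝ (Fin m)} (ha : a ∈ A) :
    ∃ v ∈ slice A p, (v : EuclideanSpace ℝ (Fin m)) + p = a :=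
  ⟨⟨a - p, AffineSubspace.vsub_mem_direction (mem_affineSpan ℝ ha) (mem_affineSpan ℝ hp)⟩,
    by simpa [slice] using ha, by simp⟩

theorem image_slice (hp : p ∈ A) :
    (fun v : (affineSpan ℝ A).direction => (v : EuclideanSpace ℝ (Fin m)) + p) '' slice A p = A := by
  refine Set.Subset.antisymm (Set.image_preimage_subset _ _) fun a ha => ?_
  exact exists_mem_slice hp ha

theorem zero_mem_slice (hp : p ∈ A) : 0 ∈ slice A p := by
  simpa [slice] using hp

theorem span_slice (hp : p ∈ A) : Submodule.span ℝ (slice A p) = ⊤ := by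
  have h : Submodule.map (affineSpan ℝ A).direction.subtype (Submodule.span ℝ (slice A p)) =
      Submodule.map (affineSpan ℝ A).direction.subtype ⊤ := by
    have himg : (affineSpan ℝ A).direction.subtype '' slice A p = (· -ᵥ p) '' A := by
      have h2 := congrArg (fun s => (· -ᵥ p) '' s) (image_slice hp)
      simp only [Set.image_image] at h2
      rw [← h2]
      simp
    rw [Submodule.map_span, Submodule.map_top, Submodule.range_subtype, himg,
      ← vectorSpan_eq_span_vsub_set_right ℝ hp, direction_affineSpan]
  exact Submodule.map_injective_of_injective (Submodule.injective_subtype _) h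

theorem norm_le_of_mem_slice {D : ℝ} (hp : p ∈ A) (hD : ∀ a ∈ A, ∀ b ∈ A, dist a b ≤ D)
    {v : (affineSpan ℝ A).direction} (hv : v ∈ slice A p) : ‖v‖ ≤ D := by
  simpa [dist_eq_norm] using hD _ hv _ hp

/-- Hausdorff measure is invariant under isometries and equals Lebesgue measure on an inner product
space of its own dimension. -/
theorem euclideanHausdorffMeasure_eq_volume_slice {k : ℕ} (hk : affDim A = k) (hp : p ∈ A) :
    Measure.euclideanHausdorffMeasure k A = volume (slice A p) := by
  subst hk
  have h := (isometry_coe_add (affineSpan ℝ A).direction p).euclideanHausdorffMeasure_image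
    (d := affDim A) (slice A p)
  rw [image_slice hp] at h
  rw [h, affDim, InnerProductSpace.euclideanHausdorffMeasure_eq_volume]

theorem affLebesgue_eq_map (h : A.Nonempty) :
    affLebesgue A = Measure.map
      (fun v : (affineSpan ℝ A).direction => (v : EuclideanSpace ℝ (Fin m)) + h.some) volume := by
  rw [affLebesgue, dif_pos h]

theorem affLebesgue_self (h : A.Nonempty) (hA : IsCompact A) :
    affLebesgue A A = volume (slice A h.some) := by
  rw [affLebesgue_eq_map h,
    Measure.map_apply (isometry_coe_add _ _).continuous.measurable hA.measurableSet]
  rfl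

/-- Integrals against the uniform distribution are averages. -/
theorem integral_uniformOn {Y : Set (EuclideanSpace ℝ (Fin m))} (hY : MeasurableSet Y)
    (hAY : A ⊆ Y) (h : A.Nonempty) (hA : IsCompact A) (g : EuclideanSpace ℝ (Fin m) → ℝ) :
    ∫ y, g y ∂(uniformOn Y A) =
      ⨍ v in slice A h.some, g ((v : EuclideanSpace ℝ (Fin m)) + h.some) := by
  have he := (isometry_coe_add (affineSpan ℝ A).direction h.some).isClosedEmbedding
  rw [uniformOn, integral_smul_measure, integral_subtype_comap hY,
    Measure.restrict_restrict hY, Set.inter_eq_right.2 hAY, affLebesgue_self h hA,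
    affLebesgue_eq_map h, he.measurableEmbedding.setIntegral_map, setAverage_eq,
    ENNReal.toReal_inv]
  rfl

/-- Taking `B` to be everything gives the total mass; taking `B = A` gives concentration on `A`. -/
theorem uniformOn_apply_of_subset {Y B : Set (EuclideanSpace ℝ (Fin m))} (hY : MeasurableSet Y)
    (hAY : A ⊆ Y) (hA : MeasurableSet A) (hAB : A ⊆ B) :
    uniformOn Y A {y : Y | (y : EuclideanSpace ℝ (Fin m)) ∈ B} =
      (affLebesgue A A)⁻¹ * affLebesgue A A := by
  have himg : Subtype.val '' {y : Y | (y : EuclideanSpace ℝ (Fin m)) ∈ B} = Y ∩ B := by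
    rw [← Subtype.image_preimage_coe]; rfl
  rw [uniformOn, Measure.smul_apply, smul_eq_mul, (MeasurableEmbedding.subtype_coe hY).comap_apply,
    himg, Measure.restrict_apply' hA, Set.inter_eq_right.2 (Set.subset_inter hAY hAB)]

end Slice

/-! ### Uniform distributions on convex bodies and their Wasserstein distance -/

section Body

variable {m k : ℕ} {A B Y : Set (EuclideanSpace ℝ (Fin m))}

theorem exists_dist_le_of_hausdorffEDist_le (hA : IsCompact A) (hA0 : A.Nonempty) {h : ℝ}
    (hh : 0 ≤ h) (hd : Metric.hausdorffEDist B A ≤ ENNReal.ofReal h)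
    {b : EuclideanSpace ℝ (Fin m)} (hb : b ∈ B) : ∃ a ∈ A, dist b a ≤ h := by
  obtain ⟨a, ha, he⟩ := hA.exists_infEDist_eq_edist hA0 b
  refine ⟨a, ha, ?_⟩
  have h1 : edist b a ≤ ENNReal.ofReal h :=
    he ▸ (Metric.infEDist_le_hausdorffEDist_of_mem hb).trans hd
  rwa [edist_dist, ENNReal.ofReal_le_ofReal_iff hh] at h1

theorem exists_mem_slice_dist_le (hB : IsCompact B) {p q : EuclideanSpace ℝ (Fin m)}
    (hq : q ∈ B) {h : ℝ} (hh : 0 ≤ h) (hd : Metric.hausdorffEDist A B ≤ ENNReal.ofReal h) :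
    ∀ v ∈ slice A p, ∃ w ∈ slice B q,
      dist ((v : EuclideanSpace ℝ (Fin m)) + p) (w + q) ≤ h := by
  intro v hv
  obtain ⟨b, hb, hvb⟩ := exists_dist_le_of_hausdorffEDist_le hB ⟨q, hq⟩ hh hd hv
  obtain ⟨w, hw, rfl⟩ := exists_mem_slice hq hb
  exact ⟨w, hw, hvb⟩

/-- `A` contains a ball of radius `r` of its affine hull. -/
def HasInball (A : Set (EuclideanSpace ℝ (Fin m))) (r : ℝ) : Prop :=
  ∃ p ∈ A, ∃ c, Metric.closedBall c r ⊆ slice A p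

/-- Changing the base point translates the slice. This is needed because `affLebesgue` uses a chosen
point of `A`. -/
theorem HasInball.exists_closedBall_subset {r : ℝ} (hr : HasInball A r)
    {q : EuclideanSpace ℝ (Fin m)} (hq : q ∈ A) : ∃ c, Metric.closedBall c r ⊆ slice A q := by
  obtain ⟨p, hp, c, hc⟩ := hr
  have hpq : p - q ∈ (affineSpan ℝ A).direction :=
    AffineSubspace.vsub_mem_direction (mem_affineSpan ℝ hp) (mem_affineSpan ℝ hq)
  refine ⟨c + ⟨p - q, hpq⟩, fun v hv => ?_⟩
  have h1 : v - ⟨p - q, hpq⟩ ∈ slice A p := by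
    apply hc
    rw [Metric.mem_closedBall, dist_eq_norm] at hv ⊢
    convert! hv using 2
    abel
  have h2 : ((v - ⟨p - q, hpq⟩ : (affineSpan ℝ A).direction) : EuclideanSpace ℝ (Fin m)) + p ∈ A :=
    h1
  have h3 : ((v - ⟨p - q, hpq⟩ : (affineSpan ℝ A).direction) : EuclideanSpace ℝ (Fin m)) + p =
      v + q := by
    rw [Submodule.coe_sub]; simp only; abel
  rw [h3] at h2
  exact h2

theorem HasInball.of_hausdorffEDist_le {r h : ℝ} (hr : HasInball A r) (hAB : affDim A = affDim B)
    (hB : Convex ℝ B) (hBc : IsCompact B) (hB0 : B.Nonempty) (hh : 0 ≤ h) (hhr : h < r)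
    (hd : Metric.hausdorffEDist A B ≤ ENNReal.ofReal h) : HasInball B (r - h) := by
  obtain ⟨p, hp, c, hc⟩ := hr
  obtain ⟨q, hq⟩ := hB0
  exact ⟨q, hq, exists_closedBall_sub_subset hAB (convex_slice hB) (isCompact_slice hBc) hh hhr hc
    (exists_mem_slice_dist_le hBc hq hh hd)⟩

theorem affLebesgue_self_ne_top (h : A.Nonempty) (hA : IsCompact A) : affLebesgue A A ≠ ∞ := by
  rw [affLebesgue_self h hA]
  exact (isCompact_slice hA).measure_ne_top

theorem affLebesgue_self_ne_zero (h : A.Nonempty) (hA : IsCompact A) {r : ℝ} (hr : 0 < r)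
    (hAr : HasInball A r) : affLebesgue A A ≠ 0 := by
  rw [affLebesgue_self h hA]
  obtain ⟨c, hc⟩ := hAr.exists_closedBall_subset h.some_mem
  exact measure_ne_zero_of_closedBall_subset hr hc

/-- A convex body contains a ball of its affine hull, of radius controlled by its volume. -/
theorem exists_hasInball (hA : Convex ℝ A) (hAc : IsCompact A) (hA0 : A.Nonempty)
    (hk : affDim A = k) {D : ℝ} (hD : ∀ a ∈ A, ∀ b ∈ A, dist a b ≤ D) :
    ∃ r > 0, HasInball A r ∧
      k * D * (Measure.euclideanHausdorffMeasure k A).toReal ≤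
        k ^ 2 * (k + 1) * 2 ^ k * D ^ k * r ∧
      (Measure.euclideanHausdorffMeasure k A).toReal ≤ 2 ^ k * D ^ k ∧
      0 < (Measure.euclideanHausdorffMeasure k A).toReal := by
  obtain ⟨p, hp⟩ := hA0
  obtain ⟨r, hr, c, hc, h1, h2⟩ := NeutralBelief.exists_closedBall_subset
    (convex_slice (p := p) hA) (isCompact_slice hAc) (zero_mem_slice hp) (span_slice hp) hk
    fun v hv => norm_le_of_mem_slice hp hD hv
  rw [euclideanHausdorffMeasure_eq_volume_slice hk hp]
  exact ⟨r, hr, ⟨p, hp, c, hc⟩, h1, h2, ENNReal.toReal_pos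
    (measure_ne_zero_of_closedBall_subset hr hc) (isCompact_slice hAc).measure_ne_top⟩

theorem isProbabilityMeasure_uniformOn (hY : MeasurableSet Y) (hAY : A ⊆ Y) (hA : Convex ℝ A)
    (hAc : IsCompact A) (hA0 : A.Nonempty) :
    IsProbabilityMeasure (uniformOn Y A) ∧
      uniformOn Y A {y : Y | (y : EuclideanSpace ℝ (Fin m)) ∈ A} = 1 := by
  obtain ⟨r, hr, hAr, -⟩ := exists_hasInball hA hAc hA0 rfl (D := Metric.diam A)
    fun a ha b hb => Metric.dist_le_diam_of_mem hAc.isBounded ha hb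
  have h1 : (affLebesgue A A)⁻¹ * affLebesgue A A = 1 :=
    ENNReal.inv_mul_cancel (affLebesgue_self_ne_zero hA0 hAc hr hAr)
      (affLebesgue_self_ne_top hA0 hAc)
  refine ⟨⟨?_⟩, ?_⟩
  · rw [← h1, ← uniformOn_apply_of_subset hY hAY hAc.measurableSet (Set.subset_univ A)]
    simp
  · rw [uniformOn_apply_of_subset hY hAY hAc.measurableSet subset_rfl, h1]

/-- A `1`-Lipschitz function on a set of diameter at most `D` is, up to a constant, the restriction
of a `1`-Lipschitz function with values in `[-D, D]`. -/
theorem exists_bounded_lipschitz_extension {Z : Type*} [PseudoMetricSpace Z] {Y : Set Z} {D : ℝ}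
    (hY0 : Y.Nonempty) (hD : ∀ a ∈ Y, ∀ b ∈ Y, dist a b ≤ D) {f : Y → ℝ}
    (hf : LipschitzWith 1 f) :
    ∃ (g : Z → ℝ) (a : ℝ), LipschitzWith 1 g ∧ (∀ x, |g x| ≤ D) ∧ ∀ y : Y, f y = g y + a := by
  obtain ⟨y₀, hy₀⟩ := hY0
  have hD0 : 0 ≤ D := dist_nonneg.trans (hD y₀ hy₀ y₀ hy₀)
  obtain ⟨F, hF, hFf⟩ : ∃ F : Z → ℝ, LipschitzWith 1 F ∧ ∀ y : Y, f y = F y := by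
    classical
    have h1 : LipschitzOnWith 1 (fun z => if h : z ∈ Y then f ⟨z, h⟩ else 0) Y := by
      rw [lipschitzOnWith_iff_restrict]
      convert! hf using 1
      ext y
      simp
    obtain ⟨F, hF, h2⟩ := h1.extend_real
    exact ⟨F, hF, fun y => by simpa using h2 y.2⟩
  have hsub : LipschitzWith 1 fun x => F x - F y₀ := by
    simpa using hF.sub (LipschitzWith.const (F y₀))
  -- Truncation at `±D` changes nothing on `Y`, where `F` differs from `F y₀` by at most the
  -- diameter bound `D`.
  refine ⟨fun x => max (min (F x - F y₀) D) (-D), F y₀, (hsub.min_const D).max_const (-D),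
    fun x => ?_, fun y => ?_⟩
  · rw [abs_le]
    exact ⟨le_max_right _ _, max_le (min_le_right _ _) (by linarith)⟩
  · have h1 := hF.dist_le_mul y y₀
    rw [NNReal.coe_one, one_mul, Real.dist_eq] at h1
    have h2 := abs_le.1 (h1.trans (hD _ y.2 _ hy₀))
    simp only [hFf]
    rw [min_eq_left h2.2, max_eq_left h2.1, sub_add_cancel]

theorem integrable_coe_of_bounded {μ : Measure Y} [IsFiniteMeasure μ]
    {g : EuclideanSpace ℝ (Fin m) → ℝ} (hg : Continuous g) {D : ℝ} (hD : ∀ x, |g x| ≤ D) :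
    Integrable (fun y : Y => g y) μ :=
  Integrable.of_bound (hg.comp continuous_subtype_val).aestronglyMeasurable D
    (Filter.Eventually.of_forall fun y => hD y)

/-- To bound the Wasserstein distance of probability measures on a set of diameter at most `D`,
test functions bounded by `D` suffice. -/
theorem wasserstein1_le_of_forall {D R : ℝ} (hY0 : Y.Nonempty)
    (hD : ∀ a ∈ Y, ∀ b ∈ Y, dist a b ≤ D) {μ ν : Measure Y} [IsProbabilityMeasure μ]
    [IsProbabilityMeasure ν]
    (H : ∀ g : EuclideanSpace ℝ (Fin m) → ℝ, LipschitzWith 1 g → (∀ x, |g x| ≤ D) →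
      (∫ y, g y ∂μ) - ∫ y, g y ∂ν ≤ R) :
    wasserstein1 μ ν ≤ ENNReal.ofReal R := by
  refine iSup₂_le fun f hf => ENNReal.ofReal_le_ofReal ?_
  obtain ⟨g, a, hg, hgD, hfg⟩ := exists_bounded_lipschitz_extension hY0 hD hf
  simp only [hfg]
  -- The additive constant cancels because both measures have mass 1.
  rw [integral_add (integrable_coe_of_bounded hg.continuous hgD) (integrable_const a),
    integral_add (integrable_coe_of_bounded hg.continuous hgD) (integrable_const a)]
  simpa using H g hg hgD

theorem wasserstein1_le_of_isProbabilityMeasure {D : ℝ} (hY0 : Y.Nonempty)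
    (hD : ∀ a ∈ Y, ∀ b ∈ Y, dist a b ≤ D) (μ ν : Measure Y) [IsProbabilityMeasure μ]
    [IsProbabilityMeasure ν] : wasserstein1 μ ν ≤ ENNReal.ofReal (2 * D) := by
  refine wasserstein1_le_of_forall hY0 hD fun g hg hgD => ?_
  have h : ∀ μ : Measure Y, IsProbabilityMeasure μ → |∫ y, g y ∂μ| ≤ D := fun μ _ => by
    simpa using norm_integral_le_of_norm_le_const (f := fun y : Y => g y) (μ := μ)
      (Filter.Eventually.of_forall fun y => hgD y)
  have h1 := abs_le.1 (h μ inferInstance)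
  have h2 := abs_le.1 (h ν inferInstance)
  linarith

/-- The Wasserstein distance of the uniform distributions on two convex bodies of the same dimension
whose Hausdorff distance is small with respect to the inradius. -/
theorem wasserstein1_uniformOn_le {D r h : ℝ} (hY : MeasurableSet Y)
    (hD : ∀ a ∈ Y, ∀ b ∈ Y, dist a b ≤ D) (hAY : A ⊆ Y) (hBY : B ⊆ Y)
    (hA : Convex ℝ A) (hAc : IsCompact A) (hA0 : A.Nonempty)
    (hB : Convex ℝ B) (hBc : IsCompact B) (hB0 : B.Nonempty)
    (hkA : affDim A = k) (hkB : affDim B = k) (hAr : HasInball A r) (hh : 0 ≤ h) (hhr : h < r)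
    (hd : Metric.hausdorffEDist A B ≤ ENNReal.ofReal h) :
    wasserstein1 (uniformOn Y A) (uniformOn Y B) ≤
      ENNReal.ofReal (h + 4 * D * (k * (h / (r - h)))) := by
  have hY0 : Y.Nonempty := hA0.mono hAY
  have := (isProbabilityMeasure_uniformOn hY hAY hA hAc hA0).1
  have := (isProbabilityMeasure_uniformOn hY hBY hB hBc hB0).1
  have hD0 : 0 ≤ D := dist_nonneg.trans (hD _ hY0.some_mem _ hY0.some_mem)
  refine wasserstein1_le_of_forall hY0 hD fun g hg hgD => ?_
  rw [integral_uniformOn hY hAY hA0 hAc, integral_uniformOn hY hBY hB0 hBc]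
  obtain ⟨c, hc⟩ := hAr.exists_closedBall_subset hA0.some_mem
  subst hkA
  refine (le_abs_self _).trans (abs_setAverage_add_sub_setAverage_add_le hkB.symm (convex_slice hA)
    (isCompact_slice hAc) (convex_slice hB) (isCompact_slice hBc) hh hhr hc
    (exists_mem_slice_dist_le hBc hB0.some_mem hh hd) (fun w hw => ?_) hg hD0 hgD)
  obtain ⟨v, hv, hwv⟩ := exists_mem_slice_dist_le hAc hA0.some_mem hh
    (Metric.hausdorffEDist_comm (s := A) ▸ hd) w hw
  exact ⟨v, hv, by rwa [dist_comm]⟩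

end Body

/-! ### Lipschitz constants, local and global -/

section Lipschitz

variable {M N : Type*} [MetricSpace M] {d : N → N → ℝ≥0∞} {f : M → N}

/-- The infimum of the Lipschitz constants is a Lipschitz constant. -/
theorem isLipOn_toNNReal_lip {A : Set M} (h : ∃ L : ℝ≥0, IsLipOn d f A L) :
    IsLipOn d f A (lip d f A).toNNReal := by
  obtain ⟨L₀, hL₀⟩ := h
  have hfin : lip d f A ≠ ∞ := ne_top_of_le_ne_top ENNReal.coe_ne_top (iInf₂_le L₀ hL₀)
  intro x hx y hy
  rw [ENNReal.coe_toNNReal hfin]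
  rcases eq_or_ne (edist x y) 0 with h0 | h0
  · have := hL₀ x hx y hy
    rw [h0, mul_zero] at this ⊢
    exact this
  · rw [← ENNReal.div_le_iff h0 (edist_ne_top x y)]
    refine le_iInf₂ fun L hL => ?_
    rw [ENNReal.div_le_iff h0 (edist_ne_top x y)]
    exact hL x hx y hy

/-- A bounded locally Lipschitz map on a compact space is Lipschitz. -/
theorem exists_isLipOn_univ_of_compactSpace [CompactSpace M] {R : ℝ} (hR : 0 ≤ R)
    (hd : ∀ x y, d (f x) (f y) ≤ ENNReal.ofReal R)
    (hloc : ∀ x, ∃ δ > 0, ∃ L : ℝ≥0, IsLipOn d f (Metric.ball x δ) L) :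
    ∃ L : ℝ≥0, IsLipOn d f Set.univ L := by
  choose δ hδ L hL using hloc
  obtain ⟨t, -, ht⟩ := isCompact_univ.elim_nhds_subcover (fun x : M => Metric.ball x (δ x))
    fun x _ => Metric.ball_mem_nhds x (hδ x)
  obtain ⟨ε, hε, hε'⟩ := lebesgue_number_lemma_of_metric (s := (Set.univ : Set M))
    (c := fun i : t => Metric.ball (i : M) (δ i)) isCompact_univ (fun i => Metric.isOpen_ball)
    (by simpa [Set.iUnion_subtype] using ht)
  refine ⟨t.sup L ⊔ (R / ε).toNNReal, fun x _ y _ => ?_⟩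
  -- Points closer than the Lebesgue number share a ball of the cover; for the others the difference
  -- quotient is at most `R / ε`.
  rcases lt_or_ge (dist y x) ε with hxy | hxy
  · obtain ⟨i, hi⟩ := hε' x trivial
    refine (hL i x (hi (Metric.mem_ball_self hε)) y (hi hxy)).trans ?_
    gcongr
    exact (Finset.le_sup (f := L) i.2).trans le_sup_left
  · refine (hd x y).trans ?_
    calc ENNReal.ofReal R ≤ ENNReal.ofReal (R / ε * dist x y) := by
          apply ENNReal.ofReal_le_ofReal
          rw [dist_comm] at hxy
          rw [div_mul_eq_mul_div, le_div_iff₀ hε]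
          gcongr
      _ = ((R / ε).toNNReal : ℝ≥0∞) * edist x y := by
          rw [ENNReal.ofReal_mul (by positivity), edist_dist]; rfl
      _ ≤ _ := by
          gcongr
          exact le_sup_right

end Lipschitz

/-! ### Local Lipschitz bound for the neutral belief -/

section Main

/-- The constant in the bound for the local Lipschitz constant of the neutral belief. -/
noncomputable def lipConst (D : ℝ) (k : ℕ) (l : ℝ) : ℝ :=
  l * (2 ^ k * D ^ k) ^ 2 * (1 + 8 * (k ^ 2 * (k + 1)))

/-- The inradius estimate bounds `k * D / r` by a multiple of `P / v`, where `P = 2 ^ k * D ^ k`. As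
`P / v ≥ 1`, both `1` and `P / v` are at most `(P / v) ^ 2`. -/
theorem mul_one_add_div_le_lipConst_div {D l r v : ℝ} {k : ℕ} (hl : 0 ≤ l)
    (hr : 0 < r) (hv : 0 < v) (h₁ : k * D * v ≤ k ^ 2 * (k + 1) * 2 ^ k * D ^ k * r)
    (h₂ : v ≤ 2 ^ k * D ^ k) : l * (1 + 8 * (k * D / r)) ≤ lipConst D k l / v ^ 2 := by
  set P : ℝ := 2 ^ k * D ^ k with hP
  have hvP : 1 ≤ P / v := (one_le_div hv).2 h₂
  have hP2 : P / v ≤ P ^ 2 / v ^ 2 := by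
    rw [← div_pow]; nlinarith
  have h3 : k * D / r ≤ k ^ 2 * (k + 1) * (P / v) := by
    rw [div_le_iff₀ hr, ← mul_le_mul_iff_left₀ hv]
    refine h₁.trans_eq ?_
    rw [hP]; field_simp
  have h4 : k ^ 2 * (k + 1) * (P / v) ≤ k ^ 2 * (k + 1) * (P ^ 2 / v ^ 2) := by gcongr
  calc l * (1 + 8 * (k * D / r))
      ≤ l * (P ^ 2 / v ^ 2 + 8 * (k ^ 2 * (k + 1) * (P ^ 2 / v ^ 2))) := by
        gcongr
        · exact hvP.trans hP2
        · exact h3.trans h4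
    _ = lipConst D k l / v ^ 2 := by rw [lipConst, ← hP]; ring

variable {X : Type*} {m k : ℕ} {Y : Set (EuclideanSpace ℝ (Fin m))}
  {S : X → Set (EuclideanSpace ℝ (Fin m))}

theorem isBelief_neutralBelief (hY : IsCompact Y) (hSY : ∀ x, S x ⊆ Y)
    (hS0 : ∀ x, (S x).Nonempty) (hS : ∀ x, Convex ℝ (S x)) (hSc : ∀ x, IsCompact (S x)) :
    IsBelief S (neutralBelief Y S) :=
  fun x => isProbabilityMeasure_uniformOn hY.measurableSet (hSY x) (hS x) (hSc x) (hS0 x)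

theorem exists_ball_isLipOn_neutralBelief [MetricSpace X] (hY : IsCompact Y)
    (hSY : ∀ x, S x ⊆ Y)
    (hS0 : ∀ x, (S x).Nonempty) (hS : ∀ x, Convex ℝ (S x)) (hSc : ∀ x, IsCompact (S x))
    (hk : ∀ x, affDim (S x) = k) {l : ℝ≥0} (hl : IsLipOn Metric.hausdorffEDist S Set.univ l)
    (x : X) :
    ∃ δ > 0, IsLipOn wasserstein1 (neutralBelief Y S) (Metric.ball x δ)
      (lipConst (Metric.diam Y) k l /
        (Measure.euclideanHausdorffMeasure k (S x)).toReal ^ 2).toNNReal := by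
  have hD : ∀ a ∈ Y, ∀ b ∈ Y, dist a b ≤ Metric.diam Y := fun a ha b hb =>
    Metric.dist_le_diam_of_mem hY.isBounded ha hb
  obtain ⟨r, hr, hxr, h₁, h₂, hv⟩ := exists_hasInball (hS x) (hSc x) (hS0 x) (hk x)
    fun a ha b hb => hD a (hSY x ha) b (hSY x hb)
  have hD0 : 0 ≤ Metric.diam Y := Metric.diam_nonneg
  have hl0 : (0 : ℝ) ≤ l := l.2
  have hbound := mul_one_add_div_le_lipConst_div hl0 hr hv h₁ h₂
  have hSl : ∀ y z, Metric.hausdorffEDist (S y) (S z) ≤ ENNReal.ofReal (l * dist y z) :=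
    fun y z => by
      rw [ENNReal.ofReal_mul hl0, ENNReal.ofReal_coe_nnreal, ← edist_dist]
      exact hl y trivial z trivial
  -- With this radius, bodies over the ball are within `r / 8` of `S x`, hence have inradius `7 * r
  -- / 8`, and are within `r / 4` of each other. Using `l + 1` allows `l = 0`.
  refine ⟨r / (8 * (l + 1)), by positivity, fun y hy z hz => ?_⟩
  have hlδ : ∀ w ∈ Metric.ball x (r / (8 * (l + 1))), (l : ℝ) * dist w x ≤ r / 8 := by
    intro w hw
    have h3 : dist w x ≤ r / (8 * (l + 1)) := (Metric.mem_ball.1 hw).le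
    calc (l : ℝ) * dist w x ≤ (l + 1) * (r / (8 * (l + 1))) := by gcongr; linarith
      _ = r / 8 := by field_simp
  have hyr : HasInball (S y) (r - r / 8) := by
    refine hxr.of_hausdorffEDist_le ((hk x).trans (hk y).symm) (hS y) (hSc y) (hS0 y)
      (by positivity) (by linarith) ((hSl x y).trans (ENNReal.ofReal_le_ofReal ?_))
    rw [dist_comm]
    exact hlδ y hy
  have hyz : (l : ℝ) * dist y z ≤ r / 4 := by
    have h3 := mul_le_mul_of_nonneg_left (dist_triangle_right y z x) hl0
    linarith [hlδ y hy, hlδ z hz]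
  have hh : 0 ≤ (l : ℝ) * dist y z := by positivity
  refine (wasserstein1_uniformOn_le hY.measurableSet hD (hSY y) (hSY z) (hS y) (hSc y) (hS0 y)
    (hS z) (hSc z) (hS0 z) (hk y) (hk z) hyr hh (by linarith) (hSl y z)).trans ?_
  rw [edist_dist]
  change _ ≤ ENNReal.ofReal _ * _
  rw [← ENNReal.ofReal_mul (le_trans (by positivity) hbound)]
  apply ENNReal.ofReal_le_ofReal
  refine le_trans ?_ (mul_le_mul_of_nonneg_right hbound dist_nonneg)
  -- The remaining radius is at least `7 * r / 8 - r / 4 = 5 * r / 8`, hence at least `r / 2`; this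
  -- turns the factor 4 into 8.
  have h3 : l * dist y z / (r - r / 8 - l * dist y z) ≤ l * dist y z / (r / 2) := by
    gcongr
    linarith
  calc l * dist y z + 4 * Metric.diam Y * (k * (l * dist y z / (r - r / 8 - l * dist y z)))
      ≤ l * dist y z + 4 * Metric.diam Y * (k * (l * dist y z / (r / 2))) := by gcongr
    _ = l * (1 + 8 * (k * Metric.diam Y / r)) * dist y z := by
      field_simp; ring

end Main

end NeutralBelief

open NeutralBelief in
theorem mainTheorem3 :
    ∃ C : ℝ → ℕ → ℕ → ℝ → ℝ,
      ∀ (m k : ℕ) (X : Type*) [MetricSpace X]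
        (Y : Set (EuclideanSpace ℝ (Fin m))) (S : X → Set (EuclideanSpace ℝ (Fin m))),
        Y.Nonempty → IsCompact Y →
        (∀ x, S x ⊆ Y) → (∀ x, (S x).Nonempty) → (∀ x, Convex ℝ (S x)) →
        (∀ x, IsCompact (S x)) → (∀ x, affDim (S x) = k) →
        (∃ L : ℝ≥0, IsLipOn Metric.hausdorffEDist S Set.univ L) →
        IsBelief S (neutralBelief Y S) ∧
        (∀ x : X,
          (∃ δ > 0, ∃ L : ℝ≥0,
            IsLipOn wasserstein1 (neutralBelief Y S) (Metric.ball x δ) L) ∧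
          lipAt wasserstein1 (neutralBelief Y S) x ≤
            ENNReal.ofReal
              (C (Metric.diam Y) m k (lip Metric.hausdorffEDist S Set.univ).toReal /
                (Measure.euclideanHausdorffMeasure k (S x)).toReal ^ 2)) ∧
        (CompactSpace X →
          ∃ L : ℝ≥0, IsLipOn wasserstein1 (neutralBelief Y S) Set.univ L) := by
  refine ⟨fun D _ k l => lipConst D k l, ?_⟩
  intro m k X _ Y S hY0 hY hSY hS0 hS hSc hk hL
  have hbel := isBelief_neutralBelief hY hSY hS0 hS hSc
  -- The infimum `lip` is itself a Lipschitz constant of `S`, so the bound can be stated with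
  -- `Lip(S)` exactly.
  have hloc := exists_ball_isLipOn_neutralBelief hY hSY hS0 hS hSc hk (isLipOn_toNNReal_lip hL)
  refine ⟨hbel, fun x => ?_, fun _ => ?_⟩
  · obtain ⟨δ, hδ, h⟩ := hloc x
    exact ⟨⟨δ, hδ, _, h⟩, iInf₂_le_of_le δ hδ (iInf₂_le_of_le _ h le_rfl)⟩
  · refine exists_isLipOn_univ_of_compactSpace (R := 2 * Metric.diam Y)
      (mul_nonneg zero_le_two Metric.diam_nonneg) (fun x y => ?_) fun x => ?_
    · have := (hbel x).1
      have := (hbel y).1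
      exact wasserstein1_le_of_isProbabilityMeasure hY0
        (fun a ha b hb => Metric.dist_le_diam_of_mem hY.isBounded ha hb) _ _
    · obtain ⟨δ, hδ, h⟩ := hloc x
      exact ⟨δ, hδ, _, h⟩
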